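/- Let $K$ be a compact Hausdorff space and let $d$ be a metric on the set $K$ which is lower semicontinuous as a function $d\colon K\times K\to[0,\infty)$, where $K \times K$ carries the product topology. Let $C(K)$ be the Banach space of continuous real functions on $K$ with the supremum norm, let $\mathrm{Lip}(K)$ be the set of real functions on $K$ that are Lipschitz with respect to $d$, and call a closed linear subspace $X$ of $C(K)$ a Lipschitz subspace if $X\subset \mathrm{Lip}(K)$. Then $d$ metrizes $K$ (that is, the topology generated by $d$ is the topology of $K$) if and only if every Lipschitz subspace of $C(K)$ is finite-dimensional. Equivalently, $\mathrm{Lip}(K)\cap C(K)$ is spaceable in $C(K)$, that is, contains an infinite-dimensional closed linear subspace of $C(K)$, if and only if $d$ does not metrize $K$. -/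

import Mathlib

namespace LipSubspace

/-- `d : K × K → [0, ∞)` is a metric on the set `K`. No relation with any topology of `K` is
required here. -/
structure IsMetric {K : Type*} (d : K → K → ℝ) : Prop where
  nonneg : ∀ x y, 0 ≤ d x y
  eq_zero_iff : ∀ x y, d x y = 0 ↔ x = y
  symm : ∀ x y, d x y = d y x
  triangle : ∀ x y z, d x z ≤ d x y + d y z

/-- The metric `d` is lower semicontinuous as a function on `K × K`, for the product of the
given topology of `K` with itself. -/
def IsLscMetric {K : Type*} [TopologicalSpace K] (d : K → K → ℝ) : Prop :=
  IsMetric d ∧ LowerSemicontinuous (fun p : K × K => d p.1 p.2)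

/-- `d` metrizes `K`: the open sets of the given topology of `K` are exactly the open sets of the
topology generated by `d`, i.e. the sets containing a `d`-ball around each of their points. -/
def Metrizes {K : Type*} [TopologicalSpace K] (d : K → K → ℝ) : Prop :=
  ∀ U : Set K, IsOpen U ↔ ∀ x ∈ U, ∃ ε > 0, ∀ y, d x y < ε → y ∈ U

/-- The real function `f` is Lipschitz with respect to `d`. -/
def IsLip {K : Type*} (d : K → K → ℝ) (f : K → ℝ) : Prop :=
  ∃ C : ℝ, ∀ s t : K, |f s - f t| ≤ C * d s t

/-- `Lip(K) ∩ C(K)`: the linear subspace of `C(K)` consisting of the `d`-Lipschitz functions. -/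
def lipC {K : Type*} [TopologicalSpace K] (d : K → K → ℝ) : Submodule ℝ C(K, ℝ) where
  carrier := {f | IsLip d f}
  zero_mem' := ⟨0, fun s t => by simp⟩
  add_mem' := by
    rintro f g ⟨C, hC⟩ ⟨D, hD⟩
    refine ⟨C + D, fun s t => ?_⟩
    have h : (f + g) s - (f + g) t = (f s - f t) + (g s - g t) := by
      simp only [ContinuousMap.add_apply]; ring
    rw [h, add_mul]
    exact (abs_add_le _ _).trans (add_le_add (hC s t) (hD s t))
  smul_mem' := by
    rintro c f ⟨C, hC⟩
    refine ⟨|c| * C, fun s t => ?_⟩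
    have h : (c • f) s - (c • f) t = c * (f s - f t) := by
      simp only [ContinuousMap.smul_apply, smul_eq_mul]; ring
    rw [h, abs_mul, mul_assoc]
    exact mul_le_mul_of_nonneg_left (hC s t) (abs_nonneg c)

/-- A Lipschitz subspace of `C(K)`: a subspace (closed for the supremum norm, i.e. a Banach
subspace) all of whose elements are Lipschitz with respect to `d`. -/
structure IsLipschitzSubspace {K : Type*} [TopologicalSpace K] [CompactSpace K]
    (d : K → K → ℝ) (X : Submodule ℝ C(K, ℝ)) : Prop where
  isClosed : IsClosed (X : Set C(K, ℝ))
  isLip : ∀ f ∈ X, IsLip d f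

/-- A linear subspace `A` of a real normed space `E` is spaceable if it contains an
infinite-dimensional closed subspace of `E`. -/
def IsSpaceable {E : Type*} [NormedAddCommGroup E] [NormedSpace ℝ E]
    (A : Submodule ℝ E) : Prop :=
  ∃ X : Submodule ℝ E, X ≤ A ∧ IsClosed (X : Set E) ∧ ¬ FiniteDimensional ℝ X

end LipSubspace

open Set Filter Topology

namespace LipSubspace

/-! If `d` metrizes `K`, Baire's theorem applied to the sets of `n`-Lipschitz elements of a
Lipschitz subspace yields a closed ball of uniformly Lipschitz functions. Such a ball is
equicontinuous, hence compact by Arzelà–Ascoli, and Riesz's theorem gives finite dimension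
(`Metrizes.finiteDimensional`). If not, some `p` has points at `d`-distance at least `ε` in each of
its neighbourhoods. A metric version of Urysohn's lemma (`exists_separating`) turns these into
disjointly supported 1-Lipschitz bumps of equal height (`exists_bumps`). In their span the norm
controls the coefficients, hence the Lipschitz constant, and this bound survives uniform limits
(`lipschitz_of_mem_span_bumps`). -/

/-- The set of points at `d`-distance at most `r` from some point of `A`. -/
def enlarge {K : Type*} (d : K → K → ℝ) (A : Set K) (r : ℝ) : Set K :=
  {y | ∃ a ∈ A, d a y ≤ r}

/-! ### Urysohn's lemma with a Lipschitz bound -/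

section Separation

variable {K : Type*} {d : K → K → ℝ}

lemma IsMetric.disjoint_enlarge (hd : IsMetric d) {A B : Set K} {r s : ℝ}
    (h : ∀ a ∈ A, ∀ b ∈ B, r + s < d a b) : Disjoint (enlarge d A r) (enlarge d B s) := by
  rw [Set.disjoint_left]
  rintro y ⟨a, ha, hay⟩ ⟨b, hb, hby⟩
  have h1 := h a ha b hb
  have h2 := hd.triangle a y b
  rw [hd.symm y b] at h2
  linarith

variable [TopologicalSpace K]

/-- Semicontinuity makes `{d ≤ r}` closed in `K × K`, and projection along a compact factor is a
closed map. -/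
lemma IsLscMetric.isClosed_enlarge [CompactSpace K] (hd : IsLscMetric d)
    {A : Set K} (hA : IsClosed A) (r : ℝ) : IsClosed (enlarge d A r) := by
  have h1 : IsClosed ((fun p : K × K => d p.1 p.2) ⁻¹' Iic r ∩ Prod.fst ⁻¹' A) :=
    (hd.2.isClosed_preimage r).inter (hA.preimage continuous_fst)
  convert isClosedMap_snd_of_compactSpace _ h1 using 1
  ext y
  simp [enlarge, and_comm]

/-- A sequence whose terms are pairwise related can be built term by term when every finite
initial segment extends. -/
lemma exists_seq_pairwise {α : Type*} (P : ℕ → α → Prop) (R : ℕ → ℕ → α → α → Prop) [Nonempty α]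
    (h : ∀ (n : ℕ) (U : ℕ → α), (∀ i < n, P i (U i)) →
      (∀ i < n, ∀ j < n, i ≠ j → R i j (U i) (U j)) →
      ∃ V, P n V ∧ ∀ i < n, R i n (U i) V ∧ R n i V (U i)) :
    ∃ U : ℕ → α, (∀ i, P i (U i)) ∧ ∀ i j, i ≠ j → R i j (U i) (U j) := by
  classical
  have h' : ∀ (n : ℕ) (U : ℕ → α), ∃ V, (∀ i < n, P i (U i)) →
      (∀ i < n, ∀ j < n, i ≠ j → R i j (U i) (U j)) →
      P n V ∧ ∀ i < n, R i n (U i) V ∧ R n i V (U i) := by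
    intro n U
    by_cases h1 : (∀ i < n, P i (U i)) ∧ ∀ i < n, ∀ j < n, i ≠ j → R i j (U i) (U j)
    · obtain ⟨V, hV⟩ := h n U h1.1 h1.2
      exact ⟨V, fun _ _ => hV⟩
    · exact ⟨Classical.arbitrary α, fun a b => (h1 ⟨a, b⟩).elim⟩
  choose V hV using h'
  let S : ℕ → ℕ → α := fun n =>
    Nat.rec (fun _ => Classical.arbitrary α) (fun n U => Function.update U n (V n U)) n
  have hS : ∀ n, S (n + 1) = Function.update (S n) n (V n (S n)) := fun n => rfl
  have hstab : ∀ n i, i < n → S n i = S (i + 1) i := by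
    intro n
    induction n with
    | zero => intro i hi; omega
    | succ n ih =>
      intro i hi
      rcases Nat.lt_succ_iff_lt_or_eq.1 hi with hlt | rfl
      · rw [hS n, Function.update_of_ne hlt.ne, ih i hlt]
      · rfl
  have hgood : ∀ n, (∀ i < n, P i (S n i)) ∧
      ∀ i < n, ∀ j < n, i ≠ j → R i j (S n i) (S n j) := by
    intro n
    induction n with
    | zero => exact ⟨fun i hi => by omega, fun i hi => by omega⟩
    | succ n ih =>
      obtain ⟨hP, hR⟩ := hV n (S n) ih.1 ih.2
      refine ⟨fun i hi => ?_, fun i hi j hj hij => ?_⟩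
      · rw [hS n]
        rcases Nat.lt_succ_iff_lt_or_eq.1 hi with hlt | rfl
        · rw [Function.update_of_ne hlt.ne]; exact ih.1 i hlt
        · rw [Function.update_self]; exact hP
      · rw [hS n]
        rcases Nat.lt_succ_iff_lt_or_eq.1 hi with hi | rfl <;>
          rcases Nat.lt_succ_iff_lt_or_eq.1 hj with hj | rfl
        · rw [Function.update_of_ne hi.ne, Function.update_of_ne hj.ne]; exact ih.2 i hi j hj hij
        · rw [Function.update_of_ne hi.ne, Function.update_self]; exact (hR i hi).1
        · rw [Function.update_of_ne hj.ne, Function.update_self]; exact (hR j hj).2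
        · exact (hij rfl).elim
  refine ⟨fun i => S (i + 1) i, fun i => (hgood (i + 1)).1 i (by omega), fun i j hij => ?_⟩
  have h1 := (hgood (max i j + 1)).2 i (by omega) j (by omega) hij
  rwa [hstab (max i j + 1) i (by omega), hstab (max i j + 1) j (by omega)] at h1

/-- The scale of open sets from which a continuous `1`-Lipschitz function separating `p` and `x`
is read off. -/
lemma IsLscMetric.exists_scale [CompactSpace K] [T2Space K] (hd : IsLscMetric d)
    {p x : K} {r : ℝ} (hr : r < d p x) (q : ℕ → ℝ) :
    ∃ U : ℕ → Set K, (∀ i, IsOpen (U i) ∧ enlarge d {p} (q i) ⊆ U i ∧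
        Disjoint (closure (U i)) (enlarge d {x} (r - q i))) ∧
      ∀ i j, i ≠ j → q i < q j → enlarge d (closure (U i)) (q j - q i) ⊆ U j := by
  refine exists_seq_pairwise (fun i U => IsOpen U ∧ enlarge d {p} (q i) ⊆ U ∧
        Disjoint (closure U) (enlarge d {x} (r - q i)))
      (fun i j U V => q i < q j → enlarge d (closure U) (q j - q i) ⊆ V) ?_
  intro n U hP hR
  set A : Set K := enlarge d {p} (q n) ∪
    ⋃ i ∈ {i | i < n ∧ q i < q n}, enlarge d (closure (U i)) (q n - q i) with hA
  -- The new set must contain `A`, and its closure must miss `B`. The union in `B` restates by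
  -- complements that enlarging the new closure stays inside each `U j` of larger index. Normality
  -- of `K` then applies, disjointness being the triangle inequality in four cases.
  set B : Set K := enlarge d {x} (r - q n) ∪
    ⋃ j ∈ {j | j < n ∧ q n < q j}, enlarge d (U j)ᶜ (q j - q n) with hB
  have hAc : IsClosed A := by
    refine (hd.isClosed_enlarge isClosed_singleton _).union (Set.Finite.isClosed_biUnion ?_ ?_)
    · exact (Set.finite_lt_nat n).subset fun i hi => hi.1
    · exact fun i _ => hd.isClosed_enlarge isClosed_closure _
  have hBc : IsClosed B := by
    refine (hd.isClosed_enlarge isClosed_singleton _).union (Set.Finite.isClosed_biUnion ?_ ?_)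
    · exact (Set.finite_lt_nat n).subset fun i hi => hi.1
    · exact fun i hi => hd.isClosed_enlarge (hP i hi.1).1.isClosed_compl _
  have hAB : Disjoint A B := by
    simp only [hA, hB, disjoint_union_left, disjoint_union_right, disjoint_iUnion_left,
      disjoint_iUnion_right]
    refine ⟨⟨?_, fun i hi => ?_⟩, fun j hj => ⟨?_, fun i hi => ?_⟩⟩
    · refine hd.1.disjoint_enlarge ?_
      rintro _ rfl _ rfl
      linarith
    · refine hd.1.disjoint_enlarge fun a ha b hb => ?_
      by_contra! hle
      exact Set.disjoint_left.1 (hP i hi.1).2.2 ha ⟨b, hb, by rw [hd.1.symm]; linarith⟩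
    · refine hd.1.disjoint_enlarge fun a ha b hb => ?_
      by_contra! hle
      exact hb ((hP j hj.1).2.1 ⟨a, ha, by linarith⟩)
    · refine hd.1.disjoint_enlarge fun a ha b hb => ?_
      by_contra! hle
      have hij : i ≠ j := by
        rintro rfl
        exact lt_asymm hi.2 hj.2
      exact hb (hR i hi.1 j hj.1 hij (hi.2.trans hj.2) ⟨a, ha, by linarith⟩)
  obtain ⟨V, hV, hAV, hVB⟩ := normal_exists_closure_subset hAc hBc.isOpen_compl
    hAB.subset_compl_right
  refine ⟨V, ⟨hV, subset_union_left.trans hAV, ?_⟩, fun i hi => ⟨fun hq => ?_, fun hq => ?_⟩⟩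
  · exact (disjoint_compl_right_iff_subset.2 subset_union_left).symm.mono_left hVB
  · refine Subset.trans ?_ hAV
    exact (subset_biUnion_of_mem (u := fun i => enlarge d (closure (U i)) (q n - q i))
      (show i ∈ {i | i < n ∧ q i < q n} from ⟨hi, hq⟩)).trans subset_union_right
  · rintro y ⟨a, ha, hay⟩
    by_contra hy
    refine hVB ha (Or.inr (mem_biUnion (show i ∈ {j | j < n ∧ q n < q j} from ⟨hi, hq⟩) ?_))
    exact ⟨y, hy, by rw [hd.1.symm]; exact hay⟩

/-- Distinct points of a compact space with a lower semicontinuous metric are separated by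
continuous `1`-Lipschitz functions, up to any value below their distance. -/
lemma IsLscMetric.exists_separating [CompactSpace K] [T2Space K] (hd : IsLscMetric d)
    {p x : K} {r : ℝ} (hr : r < d p x) :
    ∃ f : C(K, ℝ), (∀ s t, f s - f t ≤ d s t) ∧ (∀ s, 0 ≤ f s) ∧ f p = 0 ∧ r ≤ f x := by
  obtain ⟨e, he⟩ := exists_surjective_nat ℚ
  obtain ⟨U, hU, hUU⟩ := hd.exists_scale hr (fun n => (e n : ℝ))
  let T : K → Set ℝ := fun y => {a | 0 ≤ a ∧ ∃ n, (e n : ℝ) = a ∧ y ∈ U n}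
  -- As in Urysohn's lemma, `f y` is the infimum of the nonnegative rational levels whose open set
  -- contains `y`.
  let f : K → ℝ := fun y => sInf (T y)
  have hbdd : ∀ y, BddBelow (T y) := fun y => ⟨0, fun a ha => ha.1⟩
  have hp : ∀ y n, d p y ≤ e n → y ∈ U n := fun y n h => (hU n).2.1 ⟨p, rfl, h⟩
  have hne : ∀ y, (T y).Nonempty := by
    intro y
    obtain ⟨q, hq⟩ := exists_rat_gt (d p y)
    obtain ⟨n, rfl⟩ := he q
    exact ⟨e n, (hd.1.nonneg p y).trans hq.le, n, rfl, hp y n hq.le⟩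
  have hf0 : ∀ y, 0 ≤ f y := fun y => le_csInf (hne y) fun a ha => ha.1
  have hstep : ∀ (y z : K) (i j : ℕ), y ∈ closure (U i) → d y z ≤ e j - e i →
      (e i : ℝ) < e j → z ∈ U j := by
    intro y z i j hy hyz hij
    refine hUU i j ?_ hij ⟨y, hy, hyz⟩
    rintro rfl
    exact lt_irrefl _ hij
  have hlip : ∀ s t, f s - f t ≤ d s t := by
    intro s t
    rw [sub_le_iff_le_add, ← sub_le_iff_le_add']
    refine le_csInf (hne t) ?_
    rintro _ ⟨ha, n, rfl, hn⟩
    rw [sub_le_iff_le_add']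
    refine le_of_forall_gt_imp_ge_of_dense fun b hb => ?_
    obtain ⟨q, hq1, hq2⟩ := exists_rat_btwn hb
    obtain ⟨m, rfl⟩ := he q
    have hst := hd.1.nonneg s t
    refine le_trans (csInf_le (hbdd s) ⟨by linarith, m, rfl, ?_⟩) hq2.le
    by_cases h : (e n : ℝ) < e m
    · exact hstep t s n m (subset_closure hn) (by rw [hd.1.symm]; linarith) h
    · exact absurd hq1 (by linarith)
  have hcont : Continuous f := by
    rw [continuous_iff_continuousAt]
    intro y
    rw [ContinuousAt, tendsto_order]
    refine ⟨fun a ha => ?_, fun a ha => ?_⟩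
    · rcases lt_or_ge a 0 with h0 | h0
      · exact Eventually.of_forall fun z => h0.trans_le (hf0 z)
      -- Two rationals between `a` and `f y`: the closure at the lower level lies in the open set at
      -- the upper one, which omits `y`.
      obtain ⟨q, hq1, hq2⟩ := exists_rat_btwn ha
      obtain ⟨q', hq'1, hq'2⟩ := exists_rat_btwn hq2
      obtain ⟨m, rfl⟩ := he q
      obtain ⟨n, rfl⟩ := he q'
      have hy : y ∉ closure (U m) := by
        intro hy
        have h1 : y ∈ U n := hstep y y m n hy
          (by rw [(hd.1.eq_zero_iff y y).2 rfl]; linarith) hq'1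
        exact absurd (csInf_le (hbdd y) ⟨by linarith, n, rfl, h1⟩) (not_le.2 hq'2)
      filter_upwards [isClosed_closure.isOpen_compl.mem_nhds hy] with z hz
      refine hq1.trans_le (le_csInf (hne z) ?_)
      rintro _ ⟨hb, k, rfl, hk⟩
      by_contra! hlt
      exact hz (subset_closure (hstep z z k m (subset_closure hk)
          (by rw [(hd.1.eq_zero_iff z z).2 rfl]; linarith) hlt))
    · obtain ⟨_, ⟨hb, n, rfl, hn⟩, hlt⟩ := exists_lt_of_csInf_lt (hne y) ha
      filter_upwards [(hU n).1.mem_nhds hn] with z hz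
      exact (csInf_le (hbdd z) ⟨hb, n, rfl, hz⟩).trans_lt hlt
  refine ⟨⟨f, hcont⟩, hlip, hf0, le_antisymm ?_ (hf0 p), le_csInf (hne x) ?_⟩
  · obtain ⟨n, hn⟩ := he 0
    refine csInf_le (hbdd p) ⟨le_rfl, n, by simp [hn], hp p n ?_⟩
    simp [hn, (hd.1.eq_zero_iff p p).2 rfl]
  · rintro _ ⟨ha, n, rfl, hn⟩
    by_contra! hlt
    refine Set.disjoint_left.1 (hU n).2.2 (subset_closure hn) ⟨x, rfl, ?_⟩
    rw [(hd.1.eq_zero_iff x x).2 rfl]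
    linarith

end Separation

/-! ### Disjoint bumps and the subspace they span -/

section Bumps

variable {K : Type*} [TopologicalSpace K] {d : K → K → ℝ}

/-- The topology of a lower semicontinuous metric on a compact space is finer than the topology of
the space. -/
lemma IsLscMetric.exists_ball_subset [CompactSpace K] (hd : IsLscMetric d) {U : Set K}
    (hU : IsOpen U) {x : K} (hx : x ∈ U) : ∃ ε > 0, ∀ y, d x y < ε → y ∈ U := by
  rcases (Uᶜ).eq_empty_or_nonempty with h | h
  · exact ⟨1, one_pos, fun y _ => by rw [compl_empty_iff.1 h]; trivial⟩
  have hlsc : LowerSemicontinuous fun y => d x y := hd.2.comp (Continuous.prodMk_right x)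
  obtain ⟨a, ha, hmin⟩ := (hlsc.lowerSemicontinuousOn Uᶜ).exists_isMinOn h
    hU.isClosed_compl.isCompact
  refine ⟨d x a, (hd.1.nonneg x a).lt_of_ne fun h0 => ?_, fun y hy => ?_⟩
  · rw [(hd.1.eq_zero_iff x a).1 h0.symm] at hx
    exact ha hx
  · by_contra hyU
    exact absurd (hmin hyU) (not_le.2 hy)

/-- Open sets are always `d`-open, so a failure to metrize comes from a `d`-open set that is not a
neighbourhood of one of its points. -/
lemma IsLscMetric.exists_far_points [CompactSpace K] (hd : IsLscMetric d)
    (h : ¬ Metrizes d) : ∃ p : K, ∃ ε > 0, ∀ N ∈ 𝓝 p, ∃ x ∈ N, ε ≤ d p x := by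
  simp only [Metrizes, not_forall] at h
  obtain ⟨U, hU⟩ := h
  have h1 : ∀ x ∈ U, ∃ ε > 0, ∀ y, d x y < ε → y ∈ U := by
    by_contra h1
    exact hU ⟨fun ho x hx => hd.exists_ball_subset ho hx, fun h2 => (h1 h2).elim⟩
  have h2 : ¬ IsOpen U := fun ho => hU ⟨fun _ => h1, fun _ => ho⟩
  rw [isOpen_iff_mem_nhds] at h2
  push Not at h2
  obtain ⟨p, hp, hpU⟩ := h2
  obtain ⟨ε, hε, hball⟩ := h1 p hp
  refine ⟨p, ε, hε, fun N hN => ?_⟩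
  by_contra! hfar
  exact hpU (mem_of_superset hN fun x hx => hball x (hfar x hx))

/-- If the metric does not metrize the space, there are infinitely many disjointly supported
continuous `1`-Lipschitz functions with the same positive norm. -/
lemma IsLscMetric.exists_bumps [CompactSpace K] [T2Space K] (hd : IsLscMetric d)
    (h : ¬ Metrizes d) : ∃ c > 0, ∃ (f : ℕ → C(K, ℝ)) (x : ℕ → K),
      (∀ n s t, |f n s - f n t| ≤ d s t) ∧ (∀ n, f n (x n) = c) ∧
      ∀ m n s, m ≠ n → f m s = 0 ∨ f n s = 0 := by
  obtain ⟨p, ε, hε, hfar⟩ := hd.exists_far_points h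
  -- Room for three levels: at `x n` the new function reaches `3c`, the earlier ones stay below `c`,
  -- and bumps are cut off at `2c`.
  obtain ⟨c, hc, hcε⟩ : ∃ c > 0, 3 * c < ε := ⟨ε / 4, by positivity, by linarith⟩
  obtain ⟨Fx, hF, hFx⟩ := exists_seq_of_forall_finset_exists
    (fun a : C(K, ℝ) × K => (∀ s t, a.1 s - a.1 t ≤ d s t) ∧ (∀ s, 0 ≤ a.1 s) ∧ a.1 p = 0 ∧
      3 * c ≤ a.1 a.2) (fun a b => a.1 b.2 < c) (by
      intro S hS
      have hN : (⋂ a ∈ S, {y | a.1 y < c}) ∈ 𝓝 p := by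
        rw [Filter.biInter_finset_mem]
        intro a ha
        refine (isOpen_lt a.1.continuous continuous_const).mem_nhds ?_
        simpa [(hS a ha).2.2.1] using hc
      obtain ⟨x, hx, hxp⟩ := hfar _ hN
      obtain ⟨F, h1, h2, h3, h4⟩ := hd.exists_separating (hcε.trans_le hxp)
      refine ⟨(F, x), ⟨h1, h2, h3, h4⟩, fun a ha => ?_⟩
      simp only [mem_iInter] at hx
      exact hx a ha)
  let F : ℕ → C(K, ℝ) := fun n => (Fx n).1
  let x : ℕ → K := fun n => (Fx n).2
  -- `M n` is the maximum of `0` and the `F m` with `m < n`. Where the bump `f m` is nonzero, `F m >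
  -- 2c`, so `M n > 2c` kills every later `f n`.
  let M : ℕ → C(K, ℝ) := fun n => Nat.rec 0 (fun n G => G ⊔ F n) n
  have hMs : ∀ n s, M (n + 1) s = max (M n s) (F n s) := fun n s => rfl
  have hMlip : ∀ n s t, M n s - M n t ≤ d s t := by
    intro n
    induction n with
    | zero => intro s t; simpa [M] using hd.1.nonneg s t
    | succ n ih =>
      intro s t
      rw [hMs, hMs]
      have h1 := ih s t
      have h2 : F n s - F n t ≤ d s t := (hF n).1 s t
      rcases le_total (M n s) (F n s) with h3 | h3
      · rw [max_eq_right h3]; linarith [le_max_right (M n t) (F n t)]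
      · rw [max_eq_left h3]; linarith [le_max_left (M n t) (F n t)]
  have hMle : ∀ n m, m < n → ∀ s, F m s ≤ M n s := by
    intro n
    induction n with
    | zero => intro m hm; omega
    | succ n ih =>
      intro m hm s
      rw [hMs]
      rcases Nat.lt_succ_iff_lt_or_eq.1 hm with hm | rfl
      · exact le_max_of_le_left (ih m hm s)
      · exact le_max_right _ _
  have hMx : ∀ n k, n ≤ k → M n (x k) < c := by
    intro n
    induction n with
    | zero => intro k _; simpa [M] using hc
    | succ n ih =>
      intro k hk
      rw [hMs]
      exact max_lt (ih k (by omega)) (hFx n k (by omega))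
  let f : ℕ → C(K, ℝ) := fun n =>
    ⟨fun s => max 0 (min c (min (F n s - 2 * c) (2 * c - M n s))), by fun_prop⟩
  have hfv : ∀ n s, f n s = max 0 (min c (min (F n s - 2 * c) (2 * c - M n s))) :=
    fun n s => rfl
  have hlip : ∀ n s t, f n s - f n t ≤ d s t := by
    intro n s t
    have h0 := hd.1.nonneg s t
    have h1 : F n s - F n t ≤ d s t := (hF n).1 s t
    have h2 := hMlip n t s
    rw [hd.1.symm t s] at h2
    rw [hfv, hfv, sub_le_iff_le_add, ← max_add_add_left, ← min_add_add_left, ← min_add_add_left]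
    exact max_le_max (by linarith) (min_le_min (by linarith)
      (min_le_min (by linarith) (by linarith)))
  have hdisj : ∀ m n s, m < n → f m s = 0 ∨ f n s = 0 := by
    intro m n s hmn
    rw [hfv, hfv]
    rcases le_total (F m s) (2 * c) with h1 | h1
    · exact Or.inl (max_eq_left (by simp [h1]))
    · have h2 := hMle n m hmn s
      exact Or.inr (max_eq_left (by simp [h1.trans h2]))
  refine ⟨c, hc, f, x, fun n s t => abs_sub_le_iff.2 ⟨hlip n s t, ?_⟩, fun n => ?_, ?_⟩
  · rw [hd.1.symm]; exact hlip n t s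
  · have h1 : 3 * c ≤ F n (x n) := (hF n).2.2.2
    have h2 := hMx n n le_rfl
    rw [hfv, min_eq_left (le_min (by linarith) (by linarith)), max_eq_right hc.le]
  · intro m n s hmn
    rcases hmn.lt_or_gt with h1 | h1
    · exact hdisj m n s h1
    · exact (hdisj n m s h1).symm

/-- The closed linear span of a sequence of disjointly supported, normalized, uniformly Lipschitz
functions is a Lipschitz subspace. -/
lemma lipschitz_of_mem_span_bumps [CompactSpace K] {c : ℝ} (hc : 0 < c) {f : ℕ → C(K, ℝ)}
    {x : ℕ → K} (hlip : ∀ n s t, |f n s - f n t| ≤ d s t) (hx : ∀ n, f n (x n) = c)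
    (hdisj : ∀ m n s, m ≠ n → f m s = 0 ∨ f n s = 0) {g : C(K, ℝ)}
    (hg : g ∈ (Submodule.span ℝ (range f)).topologicalClosure) (s t : K) :
    |g s - g t| ≤ 2 / c * ‖g‖ * d s t := by
  have hclosed : IsClosed {g : C(K, ℝ) | |g s - g t| ≤ 2 / c * ‖g‖ * d s t} :=
    isClosed_le (by fun_prop) (by fun_prop)
  refine closure_minimal (fun g hg => ?_) hclosed hg
  obtain ⟨a, rfl⟩ := Finsupp.mem_span_range_iff_exists_finsupp.1 hg
  set g : C(K, ℝ) := a.sum fun i b => b • f i with hgdef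
  have hgv : ∀ y, g y = ∑ i ∈ a.support, a i * f i y := by
    intro y
    simp [hgdef, Finsupp.sum, ContinuousMap.coe_sum]
  have hsingle : ∀ y n, (∀ m, m ≠ n → f m y = 0) → g y = a n * f n y := by
    intro y n h
    rw [hgv, Finset.sum_eq_single n]
    · intro m _ hm; rw [h m hm, mul_zero]
    · intro hn; rw [Finsupp.notMem_support_iff.1 hn, zero_mul]
  have hpeak : ∀ y, ∃ n, ∀ m, m ≠ n → f m y = 0 := by
    intro y
    by_cases h : ∃ n, f n y ≠ 0
    · obtain ⟨n, hn⟩ := h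
      exact ⟨n, fun m hm => (hdisj m n y hm).resolve_right hn⟩
    · push Not at h
      exact ⟨0, fun m _ => h m⟩
  have hcoef : ∀ n, |a n| ≤ ‖g‖ / c := by
    intro n
    rw [le_div_iff₀ hc]
    have h1 : g (x n) = a n * c := by
      rw [← hx n]
      refine hsingle _ n fun m hm => (hdisj m n _ hm).resolve_right ?_
      rw [hx n]; exact hc.ne'
    have h2 := g.norm_coe_le_norm (x n)
    rwa [h1, Real.norm_eq_abs, abs_mul, abs_of_pos hc] at h2
  have hterm : ∀ n, |a n * f n s - a n * f n t| ≤ ‖g‖ / c * d s t := by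
    intro n
    rw [← mul_sub, abs_mul]
    exact mul_le_mul (hcoef n) (hlip n s t) (abs_nonneg _) (by positivity)
  obtain ⟨n, hn⟩ := hpeak s
  obtain ⟨m, hm⟩ := hpeak t
  change |g s - g t| ≤ 2 / c * ‖g‖ * d s t
  have hring : 2 / c * ‖g‖ * d s t = ‖g‖ / c * d s t + ‖g‖ / c * d s t := by ring
  rw [hring, hsingle s n hn, hsingle t m hm]
  -- The factor 2 arises when `s` and `t` lie under different bumps: each vanishes at the other
  -- point, so each value is itself a difference.
  by_cases hnm : n = m
  · subst hnm
    exact (hterm n).trans (le_add_of_nonneg_left ((abs_nonneg _).trans (hterm n)))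
  · have h1 := hterm n
    have h2 := hterm m
    rw [hm n hnm, mul_zero, sub_zero] at h1
    rw [hn m (Ne.symm hnm), mul_zero, zero_sub, abs_neg] at h2
    exact (abs_sub _ _).trans (add_le_add h1 h2)

lemma linearIndependent_bumps {c : ℝ} (hc : 0 < c) {f : ℕ → C(K, ℝ)}
    {x : ℕ → K} (hx : ∀ n, f n (x n) = c)
    (hdisj : ∀ m n s, m ≠ n → f m s = 0 ∨ f n s = 0) : LinearIndependent ℝ f := by
  rw [linearIndependent_iff']
  intro S a h n hn
  have h1 := congrArg (fun g : C(K, ℝ) => g (x n)) h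
  simp only [ContinuousMap.coe_sum, Finset.sum_apply, ContinuousMap.smul_apply, smul_eq_mul,
    ContinuousMap.zero_apply] at h1
  rw [Finset.sum_eq_single_of_mem n hn, hx n] at h1
  · exact (mul_eq_zero.1 h1).resolve_right hc.ne'
  · intro m _ hm
    rw [(hdisj m n _ hm).resolve_right (by rw [hx n]; exact hc.ne'), mul_zero]

lemma IsLscMetric.exists_infinite_lipschitzSubspace [CompactSpace K] [T2Space K]
    (hd : IsLscMetric d) (h : ¬ Metrizes d) :
    ∃ X : Submodule ℝ C(K, ℝ), IsLipschitzSubspace d X ∧ ¬ FiniteDimensional ℝ X := by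
  obtain ⟨c, hc, f, x, hlip, hx, hdisj⟩ := hd.exists_bumps h
  refine ⟨(Submodule.span ℝ (range f)).topologicalClosure,
    ⟨Submodule.isClosed_topologicalClosure _, fun g hg =>
      ⟨2 / c * ‖g‖, lipschitz_of_mem_span_bumps hc hlip hx hdisj hg⟩⟩, fun hfin => ?_⟩
  have hli := linearIndependent_bumps hc hx hdisj
  have hmem : ∀ n, f n ∈ (Submodule.span ℝ (range f)).topologicalClosure := fun n =>
    Submodule.le_topologicalClosure _ (Submodule.subset_span (mem_range_self n))
  have hli' : LinearIndependent ℝ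
      (fun n => (⟨f n, hmem n⟩ : (Submodule.span ℝ (range f)).topologicalClosure)) :=
    LinearIndependent.of_comp (Submodule.subtype _) hli
  have := hli'.lt_aleph0_of_finiteDimensional
  simp at this

end Bumps

/-! ### Finite dimension when `d` metrizes `K` -/

/-- If `d` metrizes the compact space `K`, then Lipschitz subspaces of `C(K)` are
finite-dimensional. -/
lemma Metrizes.finiteDimensional {K : Type*} [TopologicalSpace K] [CompactSpace K]
    {d : K → K → ℝ} (hd : IsMetric d) (hm : Metrizes d)
    {X : Submodule ℝ C(K, ℝ)} (hX : IsLipschitzSubspace d X) : FiniteDimensional ℝ X := by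
  have : CompleteSpace X := hX.isClosed.completeSpace_coe
  have : TopologicalSpace.IsCompletelyPseudoMetrizableSpace X := ⟨⟨inferInstance, rfl, this⟩⟩
  have : BaireSpace X := BaireSpace.of_completelyPseudoMetrizable
  let L : ℕ → Set X := fun n => {f | ∀ s t, |f.1 s - f.1 t| ≤ n * d s t}
  have hLc : ∀ n, IsClosed (L n) := by
    intro n
    simp only [L, ofPred_forall]
    exact isClosed_iInter fun s => isClosed_iInter fun t =>
      isClosed_le (by fun_prop) continuous_const
  have hLu : ⋃ n, L n = univ := by
    refine eq_univ_of_forall fun f => ?_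
    obtain ⟨C, hC⟩ := hX.isLip f.1 f.2
    obtain ⟨n, hn⟩ := exists_nat_ge C
    exact mem_iUnion.2 ⟨n, fun s t =>
      (hC s t).trans (mul_le_mul_of_nonneg_right hn (hd.nonneg s t))⟩
  -- By Baire, one Lipschitz constant `n` serves a whole ball of `X`.
  obtain ⟨n, f₀, hf₀⟩ := nonempty_interior_of_iUnion_of_closed hLc hLu
  obtain ⟨ρ, hρ, hball⟩ := Metric.nhds_basis_closedBall.mem_iff.1 (mem_interior_iff_mem_nhds.1 hf₀)
  refine FiniteDimensional.of_isCompact_closedBall ℝ hρ (c := f₀) ?_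
  let φ : X → BoundedContinuousFunction K ℝ := fun f => BoundedContinuousFunction.mkOfCompact f.1
  have hφ : Isometry φ :=
    (ContinuousMap.isometryEquivBoundedOfCompact K ℝ).isometry.comp isometry_subtype_coe
  rw [hφ.isClosedEmbedding.isInducing.isCompact_iff]
  refine BoundedContinuousFunction.arzela_ascoli₂ (Metric.closedBall 0 (‖f₀‖ + ρ))
    (isCompact_closedBall _ _) _ (hφ.isClosedEmbedding.isClosedMap _ Metric.isClosed_closedBall)
    ?_ ?_
  · rintro _ y ⟨f, hf, rfl⟩
    rw [mem_closedBall_zero_iff]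
    have h1 : ‖f‖ ≤ ‖f₀‖ + ρ :=
      sub_le_iff_le_add'.1 ((norm_sub_norm_le f f₀).trans (mem_closedBall_iff_norm.1 hf))
    exact (f.1.norm_coe_le_norm y).trans h1
  · intro y
    rw [Metric.equicontinuousAt_iff_right]
    intro ε hε
    have hpos : (0 : ℝ) < n + 1 := by positivity
    -- `n + 1` because `n` may be zero. Openness of this `d`-ball is where metrizability enters.
    have hδ : 0 < ε / (n + 1) := by positivity
    have hopen : IsOpen {z | d y z < ε / (n + 1)} := by
      rw [hm]
      intro z hz
      exact ⟨ε / (n + 1) - d y z, sub_pos.2 hz, fun w hw =>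
        (hd.triangle y z w).trans_lt (by linarith)⟩
    have hy : y ∈ {z | d y z < ε / (n + 1)} := by
      simpa [(hd.eq_zero_iff y y).2 rfl] using hδ
    filter_upwards [hopen.mem_nhds hy] with z hz
    rintro ⟨_, f, hf, rfl⟩
    have h1 : |f.1 y - f.1 z| ≤ n * d y z := hball hf y z
    have h2 : d y z * (n + 1) < ε := (lt_div_iff₀ hpos).1 hz
    change |f.1 y - f.1 z| < ε
    nlinarith [hd.nonneg y z]

end LipSubspace

theorem corollary4p3 {K : Type*} [TopologicalSpace K] [CompactSpace K] [T2Space K]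
    (d : K → K → ℝ) (hd : LipSubspace.IsLscMetric d) :
    (LipSubspace.Metrizes d ↔
      ∀ X : Submodule ℝ C(K, ℝ), LipSubspace.IsLipschitzSubspace d X → FiniteDimensional ℝ X) ∧
    (LipSubspace.IsSpaceable (LipSubspace.lipC d) ↔ ¬ LipSubspace.Metrizes d) := by
  refine ⟨⟨fun hm X hX => hm.finiteDimensional hd.1 hX, fun h => ?_⟩, ?_, fun hm => ?_⟩
  · by_contra hm
    obtain ⟨X, hX, hinf⟩ := hd.exists_infinite_lipschitzSubspace hm
    exact hinf (h X hX)
  · rintro ⟨X, hle, hcl, hinf⟩ hm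
    exact hinf (hm.finiteDimensional hd.1 ⟨hcl, fun f hf => hle hf⟩)
  · obtain ⟨X, hX, hinf⟩ := hd.exists_infinite_lipschitzSubspace hm
    exact ⟨X, fun f hf => hX.isLip f hf, hX.isClosed, hinf⟩
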